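/- A barotropic equation of state is a continuous function $\rho(p)$, $p\ge 0$, with $\rho(p)>0$ for $p>0$, such that $\eta(p)=\int_0^p \rho(p')^{-1}\,dp'$ exists for $p>0$. It is called asymptotically polytropic, with asymptotic indices $n_0$ (at low pressures) and $n_1$ (at high pressures), if $\eta$ runs through all of $(0,\infty)$, if $\rho$ is differentiable for $p>0$, and if the index-function $n(\eta)=\eta\,\frac{d\rho}{dp}=\frac{\eta}{\rho}\frac{d\rho}{d\eta}$ is non-negative, bounded and ${\mathcal C}^1$ on $(0,\infty)$ and satisfies $n(\eta)-n_0=O(\eta^{a_0})$ as $\eta\to 0$ and $n(\eta)-n_1=O(\eta^{-a_1})$ as $\eta\to\infty$ for some $a_0,a_1>0$. A regular perfect fluid solution of radius $R\in(0,\infty]$ is a solution $(m(r),p(r))$, $0<r<R$, of $$\frac{dm}{dr}=4\pi r^2\rho(p),\qquad \frac{dp}{dr}=-\frac{m\,\rho(p)}{r^2},$$ with $p>0$ on $(0,R)$, with $m(r)\to 0$ and $p(r)\to p_c\in(0,\infty)$ as $r\to 0$, and, if $R<\infty$, with $p(r)\to 0$ as $r\to R$. Theorem. For every real $n_0>3$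 there exists an asymptotically polytropic equation of state with asymptotic low-pressure index $n_0$ (and some high-pressure index $n_1$) for which some regular perfect fluid solution has infinite radius $R=\infty$, i.e. it exists with $p(r)>0$ for all $r>0$. -/

import Mathlib

open Set Filter Topology Asymptotics MeasureTheory

noncomputable section

/-- The quantity `η(p) = ∫₀ᵖ dp' / ρ(p')` of a barotropic equation of state `ρ = ρ(p)`. -/
def eta (ρ : ℝ → ℝ) (p : ℝ) : ℝ := ∫ s in (0 : ℝ)..p, (ρ s)⁻¹

/-- `ρ` is a barotropic equation of state: density as a continuous function of the pressure
`p ≥ 0`, positive for `p > 0`, and such that `η(p)` exists for `p > 0`. Only the values of `ρ` on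
`[0, ∞)` matter. -/
structure IsEquationOfState (ρ : ℝ → ℝ) : Prop where
  continuousOn : ContinuousOn ρ (Ici 0)
  pos : ∀ p, 0 < p → 0 < ρ p
  integrable : ∀ p, 0 < p → IntervalIntegrable (fun s => (ρ s)⁻¹) volume 0 p

/-- `n` is the index-function of `ρ`: for every `p > 0` the density is differentiable and
`n(η) = η dρ/dp = (η / ρ) dρ/dη` at `η = η(p)`. -/
def IsIndexFunction (ρ n : ℝ → ℝ) : Prop :=
  ∀ p, 0 < p → HasDerivAt ρ (n (eta ρ p) / eta ρ p) p

/-- The equation of state `ρ` is asymptotically polytropic with index `n₀` at low pressures and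
index `n₁` at high pressures. The condition `eta_tendsto` says that `η` runs through all of
`(0, ∞)`, so that the index-function is determined by `ρ` on `(0, ∞)`. -/
structure IsAsymptoticallyPolytropic (ρ : ℝ → ℝ) (n₀ n₁ : ℝ) : Prop where
  eos : IsEquationOfState ρ
  eta_tendsto : Tendsto (eta ρ) atTop atTop
  index : ∃ n : ℝ → ℝ, IsIndexFunction ρ n ∧
    ContDiffOn ℝ 1 n (Ioi 0) ∧
    (∀ x, 0 < x → 0 ≤ n x) ∧
    (∃ B : ℝ, ∀ x, 0 < x → |n x| ≤ B) ∧
    (∃ a₀ : ℝ, 0 < a₀ ∧ (fun x => n x - n₀) =O[𝓝[>] 0] (fun x => x ^ a₀)) ∧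
    (∃ a₁ : ℝ, 0 < a₁ ∧ (fun x => n x - n₁) =O[atTop] (fun x => x ^ (-a₁)))

/-- `(m, p)` is a regular static spherically symmetric perfect fluid solution (gravitational
constant `1`) with equation of state `ρ`, central pressure `pc` and radius `R ∈ (0, ∞]`: it solves
`dm/dr = 4πr²ρ`, `dp/dr = -mρ/r²` with `p > 0` for `0 < r < R`, at the centre the mass vanishes and
the pressure tends to `pc ∈ (0, ∞)`, and `p` vanishes at the surface `r = R` if `R < ∞`. -/
structure IsRegularSolution (ρ : ℝ → ℝ) (pc : ℝ) (R : EReal) (m p : ℝ → ℝ) : Prop where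
  radius_pos : 0 < R
  pc_pos : 0 < pc
  mass_center : Tendsto m (𝓝[>] 0) (𝓝 0)
  pressure_center : Tendsto p (𝓝[>] 0) (𝓝 pc)
  pressure_pos : ∀ r : ℝ, 0 < r → (r : EReal) < R → 0 < p r
  mass_eq : ∀ r : ℝ, 0 < r → (r : EReal) < R →
    HasDerivAt m (4 * Real.pi * r ^ 2 * ρ (p r)) r
  pressure_eq : ∀ r : ℝ, 0 < r → (r : EReal) < R →
    HasDerivAt p (-(m r * ρ (p r) / r ^ 2)) r
  surface : R ≠ ⊤ → Tendsto p (𝓝[<] R.toReal) (𝓝 0)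

end

/- In the variable `x = 1 / r`, with `u = η(p)`, the structure equations become `u' = m` and
`m' = -4πρ / x⁴`. A star may therefore be prescribed by its density `D(x)`, and the equation of
state is read off afterwards as `ρ = D ∘ u⁻¹`. If `D` behaves like `xⁿ` as `x → 0`, the total mass
`M` is finite exactly when `n > 3`; then `u` is asymptotic to `M x`, so `ρ` is asymptotically a
multiple of `ηⁿ` at low pressures although the star fills all of space. For `x ≥ 1` the density is
constant, which makes the centre regular, and beyond the central pressure the equation of state is
continued by the same constant, so that the high-pressure index is `0`. -/

section Calculus

theorem contDiffOn_one_of_hasDerivAt {𝕜 F : Type*} [NontriviallyNormedField 𝕜]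
    [NormedAddCommGroup F] [NormedSpace 𝕜 F] {f f' : 𝕜 → F} {s : Set 𝕜} (hs : IsOpen s)
    (hf : ∀ x ∈ s, HasDerivAt f (f' x) x) (hf' : ContinuousOn f' s) : ContDiffOn 𝕜 1 f s := by
  refine (contDiffOn_one_iff_derivWithin hs.uniqueDiffOn).2
    ⟨fun x hx => (hf x hx).differentiableAt.differentiableWithinAt, hf'.congr fun x hx => ?_⟩
  rw [derivWithin_of_isOpen hs hx, (hf x hx).deriv]

theorem hasDerivAt_max_zero_pow (k : ℕ) (x : ℝ) :
    HasDerivAt (fun y : ℝ => max y 0 ^ (k + 2)) ((k + 2) * max x 0 ^ (k + 1)) x := by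
  refine hasDerivAt_of_hasDerivAt_of_ne' (x := 0) (g := fun x => (k + 2) * max x 0 ^ (k + 1))
    (fun y hy => ?_) (by fun_prop) (by fun_prop) x
  rcases hy.lt_or_gt with hneg | hpos
  · rw [max_eq_right hneg.le, zero_pow k.succ_ne_zero, mul_zero]
    refine (hasDerivAt_const y (0 : ℝ)).congr_of_eventuallyEq ?_
    filter_upwards [eventually_lt_nhds hneg] with z hz
    rw [max_eq_right hz.le, zero_pow (by lia)]
  · rw [max_eq_left hpos.le]
    refine ((hasDerivAt_pow (k + 2) y).congr_of_eventuallyEq ?_).congr_deriv (by push_cast; rfl)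
    filter_upwards [eventually_gt_nhds hpos] with z hz
    rw [max_eq_left hz.le]

theorem exists_orderIso_eqOn_Ici {F : ℝ → ℝ} {a : ℝ} (hc : ContinuousOn F (Ici a))
    (hF : StrictMonoOn F (Ici a)) (htop : Tendsto F atTop atTop) :
    ∃ e : ℝ ≃o ℝ, EqOn e F (Ici a) := by
  let H : ℝ → ℝ := fun x => F (max x a) + min (x - a) 0
  have hHF : EqOn H F (Ici a) := fun x (hx : a ≤ x) => by simp [H, hx]
  have hH_affine : EqOn H (fun x => F a + (x - a)) (Iic a) := fun x (hx : x ≤ a) => by simp [H, hx]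
  have hH_cont : Continuous H :=
    (hc.comp_continuous (by fun_prop) fun x => le_max_right x a).add (by fun_prop)
  have hH_mono : StrictMono H :=
    StrictMonoOn.Iic_union_Ici
      (StrictMonoOn.congr (fun x _ y _ hxy => by simpa using hxy) hH_affine.symm)
      (hF.congr hHF.symm)
  have hH_top : Tendsto H atTop atTop :=
    htop.congr' ((eventually_ge_atTop a).mono fun x hx => (hHF hx).symm)
  have hH_bot : Tendsto H atBot atBot := by
    refine Tendsto.congr' ((eventually_le_atBot a).mono fun x hx => (hH_affine hx).symm) ?_
    exact tendsto_atBot_add_const_left _ _ (tendsto_atBot_add_const_right _ (-a) tendsto_id)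
  exact ⟨hH_mono.orderIsoOfSurjective H (hH_cont.surjective hH_top hH_bot), hHF⟩

theorem hasDerivAt_orderIso_symm {e : ℝ ≃o ℝ} {e' y : ℝ} (he : HasDerivAt e e' (e.symm y))
    (he' : e' ≠ 0) : HasDerivAt e.symm e'⁻¹ y :=
  HasDerivAt.of_local_left_inverse e.symm.continuous.continuousAt he he'
    (Eventually.of_forall e.apply_symm_apply)

variable {E : Type*} [NormedAddCommGroup E] [NormedSpace ℝ E]

theorem hasDerivAt_integral_Ioi [CompleteSpace E] {g : ℝ → E} {a x : ℝ}
    (hg : IntegrableOn g (Ioi a)) (hx : a < x) (hc : ContinuousAt g x) :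
    HasDerivAt (fun y => ∫ s in Ioi y, g s) (-g x) x := by
  have hint : IntervalIntegrable g volume a x :=
    (intervalIntegrable_iff_integrableOn_Ioc_of_le hx.le).2 (hg.mono_set Ioc_subset_Ioi_self)
  have hmeas : StronglyMeasurableAtFilter g (𝓝 x) :=
    ⟨Ioi a, Ioi_mem_nhds hx, hg.aestronglyMeasurable⟩
  refine ((intervalIntegral.integral_hasDerivAt_right hint hmeas hc).const_sub
    (∫ s in Ioi a, g s)).congr_of_eventuallyEq ?_
  filter_upwards [eventually_gt_nhds hx] with y hy
  rw [← intervalIntegral.integral_Ioi_sub_Ioi hg hy.le, sub_sub_cancel]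

theorem hasDerivAt_integral_of_continuousOn_Ici [CompleteSpace E] {g : ℝ → E}
    {a x : ℝ} (hg : ContinuousOn g (Ici a)) (hx : a < x) :
    HasDerivAt (fun y => ∫ s in a..y, g s) (g x) x := by
  refine intervalIntegral.integral_hasDerivAt_right (hg.mono ?_).intervalIntegrable
    ((hg.mono Ioi_subset_Ici_self).stronglyMeasurableAtFilter isOpen_Ioi x hx)
    (hg.continuousAt (Ici_mem_nhds hx))
  rw [uIcc_of_le hx.le]
  exact Icc_subset_Ici_self

theorem continuousOn_primitive_Ici {g : ℝ → E} {a : ℝ} (hg : ContinuousOn g (Ici a)) :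
    ContinuousOn (fun y => ∫ s in a..y, g s) (Ici a) := by
  intro x hx
  have hax : a ≤ x + 1 := (mem_Ici.1 hx).trans (le_add_of_nonneg_right zero_le_one)
  have hint : IntegrableOn g (uIcc a (x + 1)) := by
    rw [uIcc_of_le hax]
    exact (hg.mono Icc_subset_Ici_self).integrableOn_Icc
  have hcont := intervalIntegral.continuousOn_primitive_interval hint
  rw [uIcc_of_le hax, ← Ici_inter_Iic] at hcont
  exact (hcont x ⟨hx, (lt_add_one x).le⟩).mono_of_mem_nhdsWithin
    (inter_mem_nhdsWithin _ (Iic_mem_nhds (lt_add_one x)))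

end Calculus

section PotentialParametrization

/-- `f` is the density of a barotropic fluid as a function of `η`, and `P` the corresponding
pressure `p(η) = ∫₀^η f`, obtained from `dη = dp / ρ`; the equation of state is `f ∘ P.symm`. Only
`η ≥ 0` matters: for convenience `P` is extended to an order isomorphism of `ℝ`. -/
structure IsPressureOf (f : ℝ → ℝ) (P : ℝ ≃o ℝ) : Prop where
  continuousOn : ContinuousOn f (Ici 0)
  pos : ∀ y, 0 < y → 0 < f y
  apply_eq_integral : ∀ y, 0 ≤ y → P y = ∫ t in (0 : ℝ)..y, f t

theorem exists_isPressureOf {f : ℝ → ℝ} {c : ℝ} (hf : ContinuousOn f (Ici 0))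
    (hpos : ∀ y, 0 < y → 0 < f y) (hc : 0 < c) (hfc : ∀ᶠ y in atTop, c ≤ f y) :
    ∃ P, IsPressureOf f P := by
  have hmono : StrictMonoOn (fun y => ∫ t in (0 : ℝ)..y, f t) (Ici 0) := by
    refine strictMonoOn_of_deriv_pos (convex_Ici 0) (continuousOn_primitive_Ici hf) fun y hy => ?_
    rw [interior_Ici] at hy
    rw [(hasDerivAt_integral_of_continuousOn_Ici hf hy).deriv]
    exact hpos y hy
  have htop : Tendsto (fun y => ∫ t in (0 : ℝ)..y, f t) atTop atTop := by
    obtain ⟨b, hb0, hb⟩ : ∃ b, 0 ≤ b ∧ ∀ y, b ≤ y → c ≤ f y :=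
      ((eventually_ge_atTop 0).and (eventually_forall_ge_atTop.2 hfc)).exists
    have hint : ∀ {x y : ℝ}, 0 ≤ x → x ≤ y → IntervalIntegrable f volume x y := fun hx hxy =>
      (hf.mono (uIcc_of_le hxy ▸ Icc_subset_Ici_self.trans
        (Ici_subset_Ici.2 hx))).intervalIntegrable
    refine tendsto_atTop_mono' atTop ?_ <|
      tendsto_atTop_add_const_left _ (∫ t in (0 : ℝ)..b, f t) <|
      (tendsto_atTop_add_const_right _ (-b) tendsto_id).atTop_mul_const hc
    filter_upwards [eventually_ge_atTop b] with y hy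
    rw [← intervalIntegral.integral_add_adjacent_intervals (hint le_rfl hb0) (hint hb0 hy)]
    gcongr
    simpa [← sub_eq_add_neg] using intervalIntegral.integral_mono_on hy
      intervalIntegrable_const (hint hb0 hy) fun t ht => hb t ht.1
  obtain ⟨P, hP⟩ := exists_orderIso_eqOn_Ici (continuousOn_primitive_Ici hf) hmono htop
  exact ⟨P, hf, hpos, hP⟩

namespace IsPressureOf

variable {f : ℝ → ℝ} {P : ℝ ≃o ℝ} {p y : ℝ}

theorem map_zero (h : IsPressureOf f P) : P 0 = 0 := by
  rw [h.apply_eq_integral 0 le_rfl, intervalIntegral.integral_same]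

theorem symm_zero (h : IsPressureOf f P) : P.symm 0 = 0 := by
  rw [P.symm_apply_eq, h.map_zero]

theorem map_pos (h : IsPressureOf f P) (hy : 0 < y) : 0 < P y :=
  h.map_zero ▸ P.strictMono hy

theorem symm_pos (h : IsPressureOf f P) (hp : 0 < p) : 0 < P.symm p :=
  h.symm_zero ▸ P.symm.strictMono hp

theorem hasDerivAt (h : IsPressureOf f P) (hy : 0 < y) : HasDerivAt P (f y) y := by
  refine (hasDerivAt_integral_of_continuousOn_Ici h.continuousOn hy).congr_of_eventuallyEq ?_
  filter_upwards [eventually_gt_nhds hy] with z hz using h.apply_eq_integral z hz.le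

theorem hasDerivAt_symm (h : IsPressureOf f P) (hp : 0 < p) :
    HasDerivAt P.symm (f (P.symm p))⁻¹ p :=
  hasDerivAt_orderIso_symm (h.hasDerivAt (h.symm_pos hp)) (h.pos _ (h.symm_pos hp)).ne'

theorem isEquationOfState (h : IsPressureOf f P) : IsEquationOfState (f ∘ P.symm) where
  continuousOn := h.continuousOn.comp P.symm.continuous.continuousOn fun _ hp =>
    h.symm_zero ▸ P.symm.monotone hp
  pos _ hp := h.pos _ (h.symm_pos hp)
  integrable p hp := by
    refine intervalIntegral.intervalIntegrable_deriv_of_nonneg P.symm.continuous.continuousOn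
      (fun s hs => h.hasDerivAt_symm ?_) (fun s hs => (inv_pos.2 (h.pos _ (h.symm_pos ?_))).le)
    all_goals exact (min_eq_left hp.le ▸ hs.1 : 0 < s)

theorem eta_eq_symm (h : IsPressureOf f P) (hp : 0 < p) : eta (f ∘ P.symm) p = P.symm p := by
  have hFTC := intervalIntegral.integral_eq_sub_of_hasDerivAt_of_le hp.le
    P.symm.continuous.continuousOn (fun s hs => h.hasDerivAt_symm hs.1)
    (h.isEquationOfState.integrable p hp)
  rwa [h.symm_zero, sub_zero] at hFTC

theorem tendsto_eta (h : IsPressureOf f P) : Tendsto (eta (f ∘ P.symm)) atTop atTop :=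
  P.symm.tendsto_atTop.congr' <|
    (eventually_gt_atTop 0).mono fun _ hp => (h.eta_eq_symm hp).symm

theorem isIndexFunction (h : IsPressureOf f P) {n : ℝ → ℝ}
    (hn : ∀ y, 0 < y → HasDerivAt f (n y * f y / y) y) : IsIndexFunction (f ∘ P.symm) n := by
  intro p hp
  have hf := (h.pos _ (h.symm_pos hp)).ne'
  rw [h.eta_eq_symm hp]
  refine ((hn _ (h.symm_pos hp)).comp p (h.hasDerivAt_symm hp)).congr_deriv ?_
  field_simp

theorem isRegularSolution (h : IsPressureOf f P) {m u : ℝ → ℝ} {uc : ℝ}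
    (hm : ∀ x, 0 < x → HasDerivAt m (-(4 * Real.pi * f (u x) / x ^ 4)) x)
    (hu : ∀ x, 0 < x → HasDerivAt u (m x) x) (hu_pos : ∀ x, 0 < x → 0 < u x)
    (hm_lim : Tendsto m atTop (𝓝 0)) (hu_lim : Tendsto u atTop (𝓝 uc)) (huc : 0 < uc) :
    IsRegularSolution (f ∘ P.symm) (P uc) ⊤ (fun r => m r⁻¹) (fun r => P (u r⁻¹)) where
  radius_pos := EReal.zero_lt_top
  pc_pos := h.map_pos huc
  mass_center := hm_lim.comp tendsto_inv_nhdsGT_zero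
  pressure_center :=
    (P.continuous.tendsto uc).comp (hu_lim.comp tendsto_inv_nhdsGT_zero)
  pressure_pos _ hr _ := h.map_pos (hu_pos _ (inv_pos.2 hr))
  mass_eq r hr _ := by
    rw [Function.comp_apply, P.symm_apply_apply]
    refine ((hm _ (inv_pos.2 hr)).comp r (hasDerivAt_inv hr.ne')).congr_deriv ?_
    field_simp
  pressure_eq r hr _ := by
    have hx := inv_pos.2 hr
    rw [Function.comp_apply, P.symm_apply_apply]
    refine ((h.hasDerivAt (hu_pos _ hx)).comp r
      ((hu _ hx).comp r (hasDerivAt_inv hr.ne'))).congr_deriv ?_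
    field_simp
  surface hR := absurd rfl hR

end IsPressureOf

end PotentialParametrization

section StellarProfile

/-- The mass per unit of inverse radius, for a density `D` given as a function of the inverse
radius: `4πr²ρ dr` in the variable `x = 1 / r`. -/
noncomputable def massRate (D : ℝ → ℝ) (x : ℝ) : ℝ := 4 * Real.pi * D x / x ^ 4

theorem massRate_pos {D : ℝ → ℝ} {x : ℝ} (hx : 0 < x) (hD : 0 < D x) : 0 < massRate D x := by
  unfold massRate
  positivity

theorem continuousOn_massRate {D : ℝ → ℝ} (hD : ContinuousOn D (Ioi 0)) :
    ContinuousOn (massRate D) (Ioi 0) :=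
  (continuousOn_const.mul hD).div (by fun_prop) fun s (hs : 0 < s) => by positivity

/-- The mass inside the radius `1 / x`. -/
noncomputable def enclosedMass (D : ℝ → ℝ) (x : ℝ) : ℝ := ∫ s in Ioi x, massRate D s

theorem tendsto_enclosedMass_atTop (D : ℝ → ℝ) : Tendsto (enclosedMass D) atTop (𝓝 0) :=
  tendsto_integral_Ioi_zero tendsto_id

/-- The work per unit mass done by gravity on the way from infinity to the radius `1 / x`; it is
`η(p)` at that radius because `dη = dp / ρ = -m dr / r²`. -/
noncomputable def newtonPotential (D : ℝ → ℝ) (x : ℝ) : ℝ := ∫ s in (0 : ℝ)..x, enclosedMass D s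

/-- `D` is the density, as a function of the inverse radius, of a spherically symmetric body of
infinite radius and finite mass. -/
structure IsStellarProfile (D : ℝ → ℝ) : Prop where
  continuousOn : ContinuousOn D (Ici 0)
  pos : ∀ x, 0 < x → 0 < D x
  integrableOn : IntegrableOn (massRate D) (Ioi 0)

namespace IsStellarProfile

variable {D : ℝ → ℝ} {x : ℝ}

theorem hasDerivAt_enclosedMass (h : IsStellarProfile D) (hx : 0 < x) :
    HasDerivAt (enclosedMass D) (-massRate D x) x :=
  hasDerivAt_integral_Ioi h.integrableOn hx <|
    (continuousOn_massRate (h.continuousOn.mono Ioi_subset_Ici_self)).continuousAt (Ioi_mem_nhds hx)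

theorem continuousOn_enclosedMass (h : IsStellarProfile D) :
    ContinuousOn (enclosedMass D) (Ici 0) :=
  h.integrableOn.continuousOn_Ici_primitive_Ioi

theorem strictAntiOn_enclosedMass (h : IsStellarProfile D) :
    StrictAntiOn (enclosedMass D) (Ici 0) := by
  refine strictAntiOn_of_deriv_neg (convex_Ici 0) h.continuousOn_enclosedMass fun x hx => ?_
  rw [interior_Ici, mem_Ioi] at hx
  rw [(h.hasDerivAt_enclosedMass hx).deriv, neg_lt_zero]
  exact massRate_pos hx (h.pos x hx)

theorem enclosedMass_pos (h : IsStellarProfile D) (hx : 0 ≤ x) : 0 < enclosedMass D x := by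
  have hx1 : 0 < x + 1 := by positivity
  refine lt_of_le_of_lt (setIntegral_nonneg measurableSet_Ioi fun s hs =>
    (massRate_pos (hx1.trans hs) (h.pos s (hx1.trans hs))).le)
    (h.strictAntiOn_enclosedMass hx hx1.le (lt_add_one x))

theorem enclosedMass_zero_sub (h : IsStellarProfile D) (hx : 0 ≤ x) :
    enclosedMass D 0 - enclosedMass D x = ∫ s in (0 : ℝ)..x, massRate D s :=
  intervalIntegral.integral_Ioi_sub_Ioi h.integrableOn hx

theorem hasDerivAt_newtonPotential (h : IsStellarProfile D) (hx : 0 < x) :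
    HasDerivAt (newtonPotential D) (enclosedMass D x) x :=
  hasDerivAt_integral_of_continuousOn_Ici h.continuousOn_enclosedMass hx

theorem continuousOn_newtonPotential (h : IsStellarProfile D) :
    ContinuousOn (newtonPotential D) (Ici 0) :=
  continuousOn_primitive_Ici h.continuousOn_enclosedMass

theorem intervalIntegrable_enclosedMass (h : IsStellarProfile D) (hx : 0 ≤ x) :
    IntervalIntegrable (enclosedMass D) volume 0 x :=
  (h.continuousOn_enclosedMass.mono (uIcc_of_le hx ▸ Icc_subset_Ici_self)).intervalIntegrable

theorem mul_enclosedMass_le_newtonPotential (h : IsStellarProfile D) (hx : 0 ≤ x) :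
    x * enclosedMass D x ≤ newtonPotential D x := by
  simpa [newtonPotential] using intervalIntegral.integral_mono_on hx intervalIntegrable_const
    (h.intervalIntegrable_enclosedMass hx)
    fun s hs => h.strictAntiOn_enclosedMass.antitoneOn hs.1 hx hs.2

theorem newtonPotential_le_mul_enclosedMass_zero (h : IsStellarProfile D) (hx : 0 ≤ x) :
    newtonPotential D x ≤ x * enclosedMass D 0 := by
  simpa [newtonPotential] using intervalIntegral.integral_mono_on hx
    (h.intervalIntegrable_enclosedMass hx) intervalIntegrable_const fun s hs =>
      h.strictAntiOn_enclosedMass.antitoneOn self_mem_Ici hs.1 hs.1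

theorem newtonPotential_pos (h : IsStellarProfile D) (hx : 0 < x) : 0 < newtonPotential D x :=
  (mul_pos hx (h.enclosedMass_pos hx.le)).trans_le (h.mul_enclosedMass_le_newtonPotential hx.le)

end IsStellarProfile

end StellarProfile

section DensitySlope

/-- `κ` is an admissible logarithmic slope `d log D / d log x` of a density `D` in the variable
`x = 1 / r`: the density is constant for `r ≤ 1`, and `κ` tends to `n` at a power rate as
`r → ∞`. -/
structure IsDensitySlope (κ : ℝ → ℝ) (n a C : ℝ) : Prop where
  exponent_pos : 0 < a
  contDiffOn : ContDiffOn ℝ 1 κ (Ioi 0)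
  nonneg : ∀ x, 0 < x → 0 ≤ κ x
  eq_zero : ∀ x, 1 ≤ x → κ x = 0
  abs_sub_le : ∀ x ∈ Ioc (0 : ℝ) 1, |κ x - n| ≤ C * x ^ a

/-- The density with logarithmic slope `κ`, normalized to `1` at `x = 1`. The factor `x ^ n` is
split off so that the remaining integral converges at `0`. -/
noncomputable def slopeDensity (n : ℝ) (κ : ℝ → ℝ) (x : ℝ) : ℝ :=
  x ^ n * Real.exp (∫ s in (1 : ℝ)..x, (κ s - n) / s)

theorem slopeDensity_pos (n : ℝ) (κ : ℝ → ℝ) {x : ℝ} (hx : 0 < x) : 0 < slopeDensity n κ x := by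
  unfold slopeDensity
  positivity

namespace IsDensitySlope

variable {κ : ℝ → ℝ} {n a C x : ℝ}

theorem bound_nonneg (h : IsDensitySlope κ n a C) : 0 ≤ C := by
  simpa using (abs_nonneg (κ 1 - n)).trans (h.abs_sub_le 1 ⟨one_pos, le_rfl⟩)

theorem hasDerivAt_slopeDensity (h : IsDensitySlope κ n a C) (hx : 0 < x) :
    HasDerivAt (slopeDensity n κ) (κ x * slopeDensity n κ x / x) x := by
  have hcont : ContinuousOn (fun s => (κ s - n) / s) (Ioi 0) :=
    (h.contDiffOn.continuousOn.sub continuousOn_const).div continuousOn_id fun s hs => ne_of_gt hs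
  have hint : IntervalIntegrable (fun s => (κ s - n) / s) volume 1 x :=
    (hcont.mono (ordConnected_Ioi.uIcc_subset one_pos hx)).intervalIntegrable
  have hexp := (intervalIntegral.integral_hasDerivAt_right hint
    (hcont.stronglyMeasurableAtFilter isOpen_Ioi x hx) (hcont.continuousAt (Ioi_mem_nhds hx))).exp
  refine ((Real.hasDerivAt_rpow_const (Or.inl hx.ne')).mul hexp).congr_deriv ?_
  rw [slopeDensity, Real.rpow_sub_one hx.ne']
  field_simp
  ring

theorem slopeDensity_eq_one (h : IsDensitySlope κ n a C) (hx : 1 ≤ x) :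
    slopeDensity n κ x = 1 := by
  have hx0 : 0 < x := one_pos.trans_le hx
  have hint : ∫ s in (1 : ℝ)..x, (κ s - n) / s = -(Real.log x * n) := by
    calc ∫ s in (1 : ℝ)..x, (κ s - n) / s = ∫ s in (1 : ℝ)..x, -n * s⁻¹ := by
          refine intervalIntegral.integral_congr fun s hs => ?_
          rw [uIcc_of_le hx] at hs
          simp only [h.eq_zero s hs.1, zero_sub, div_eq_mul_inv]
      _ = -(Real.log x * n) := by
          rw [intervalIntegral.integral_const_mul, integral_inv_of_pos one_pos hx0, div_one]
          ring
  rw [slopeDensity, hint, Real.rpow_def_of_pos hx0, ← Real.exp_add, add_neg_cancel, Real.exp_zero]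

theorem slopeDensity_le (h : IsDensitySlope κ n a C) (hx : x ∈ Ioc (0 : ℝ) 1) :
    slopeDensity n κ x ≤ Real.exp (C / a) * x ^ n := by
  have ha := h.exponent_pos
  have hint : ‖∫ s in x..1, (κ s - n) / s‖ ≤ ∫ s in x..1, C * s ^ (a - 1) := by
    refine intervalIntegral.norm_integral_le_of_norm_le hx.2 (Eventually.of_forall fun s hs => ?_)
      ((intervalIntegral.intervalIntegrable_rpow' (by linarith)).const_mul C)
    have hs0 : 0 < s := hx.1.trans hs.1
    rw [norm_div, Real.norm_eq_abs, Real.norm_of_nonneg hs0.le, Real.rpow_sub_one hs0.ne',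
      mul_div_assoc']
    gcongr
    exact h.abs_sub_le s ⟨hs0, hs.2⟩
  have hbound : ∫ s in x..1, C * s ^ (a - 1) ≤ C / a := by
    rw [intervalIntegral.integral_const_mul, integral_rpow (Or.inl (by linarith)), sub_add_cancel,
      Real.one_rpow, mul_div_assoc', mul_one_sub]
    gcongr
    exact sub_le_self _ (mul_nonneg h.bound_nonneg (Real.rpow_nonneg hx.1.le a))
  rw [slopeDensity, mul_comm, intervalIntegral.integral_symm]
  gcongr
  · exact Real.rpow_nonneg hx.1.le n
  · exact (neg_le_abs _).trans (hint.trans hbound)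

theorem continuousOn_slopeDensity (h : IsDensitySlope κ n a C) (hn : 0 < n) :
    ContinuousOn (slopeDensity n κ) (Ici 0) := by
  intro x (hx : 0 ≤ x)
  rcases hx.eq_or_lt with rfl | hx
  · have hlim : Tendsto (fun x : ℝ => Real.exp (C / a) * x ^ n) (𝓝[≥] 0) (𝓝 0) := by
      have hcont := (Real.continuousAt_rpow_const 0 n (Or.inr hn.le)).const_mul (Real.exp (C / a))
      rw [ContinuousAt, Real.zero_rpow hn.ne', mul_zero] at hcont
      exact hcont.mono_left nhdsWithin_le_nhds
    have hzero : slopeDensity n κ 0 = 0 := by rw [slopeDensity, Real.zero_rpow hn.ne', zero_mul]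
    rw [ContinuousWithinAt, hzero]
    refine tendsto_of_tendsto_of_tendsto_of_le_of_le' tendsto_const_nhds hlim ?_ ?_
    all_goals filter_upwards [Icc_mem_nhdsGE one_pos] with x hx
    all_goals rcases hx.1.eq_or_lt with rfl | hx0
    · exact hzero.ge
    · exact (slopeDensity_pos n κ hx0).le
    · rw [hzero, Real.zero_rpow hn.ne', mul_zero]
    · exact h.slopeDensity_le ⟨hx0, hx.2⟩
  · exact (h.hasDerivAt_slopeDensity hx).continuousAt.continuousWithinAt

theorem massRate_le (h : IsDensitySlope κ n a C) (hx : x ∈ Ioc (0 : ℝ) 1) :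
    massRate (slopeDensity n κ) x ≤ 4 * Real.pi * Real.exp (C / a) * x ^ (n - 4) := by
  calc massRate (slopeDensity n κ) x
      ≤ 4 * Real.pi * (Real.exp (C / a) * x ^ n) / x ^ 4 := by
        have := hx.1
        unfold massRate
        gcongr
        exact h.slopeDensity_le hx
    _ = 4 * Real.pi * Real.exp (C / a) * x ^ (n - 4) := by
        rw [← Nat.cast_ofNat (R := ℝ) (n := 4), Real.rpow_sub_natCast hx.1.ne']
        push_cast
        ring

theorem massRate_of_one_le (h : IsDensitySlope κ n a C) (hx : 1 ≤ x) :
    massRate (slopeDensity n κ) x = 4 * Real.pi * x ^ (-4 : ℝ) := by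
  rw [massRate, h.slopeDensity_eq_one hx, mul_one, Real.rpow_neg (zero_le_one.trans hx),
    div_eq_mul_inv]
  norm_cast

theorem isStellarProfile (h : IsDensitySlope κ n a C) (hn : 3 < n) :
    IsStellarProfile (slopeDensity n κ) where
  continuousOn := h.continuousOn_slopeDensity (by linarith)
  pos _ hx := slopeDensity_pos n κ hx
  integrableOn := by
    rw [← Ioc_union_Ioi_eq_Ioi zero_le_one]
    refine IntegrableOn.union (Integrable.mono'
      ((intervalIntegral.intervalIntegrable_rpow' (by linarith : -1 < n - 4)).1.const_mul
        (4 * Real.pi * Real.exp (C / a))) (ContinuousOn.aestronglyMeasurable ?_ measurableSet_Ioc)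
      ?_) ?_
    · exact (continuousOn_massRate fun s hs =>
        (h.hasDerivAt_slopeDensity hs).continuousAt.continuousWithinAt).mono Ioc_subset_Ioi_self
    · refine ae_restrict_of_forall_mem measurableSet_Ioc fun s hs => ?_
      rw [Real.norm_of_nonneg (massRate_pos hs.1 (slopeDensity_pos n κ hs.1)).le]
      exact h.massRate_le hs
    · refine (integrableOn_congr_fun (fun s hs => h.massRate_of_one_le (mem_Ioi.1 hs).le)
        measurableSet_Ioi).2 ?_
      exact (integrableOn_Ioi_rpow_of_lt (by norm_num) one_pos).const_mul _

theorem enclosedMass_zero_sub_le (h : IsDensitySlope κ n a C) (hn : 3 < n)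
    (hx : x ∈ Ioc (0 : ℝ) 1) :
    enclosedMass (slopeDensity n κ) 0 - enclosedMass (slopeDensity n κ) x ≤
      4 * Real.pi * Real.exp (C / a) / (n - 3) * x ^ (n - 3) := by
  have hD := h.isStellarProfile hn
  calc _ = ∫ s in (0 : ℝ)..x, massRate (slopeDensity n κ) s :=
        hD.enclosedMass_zero_sub hx.1.le
    _ ≤ ∫ s in (0 : ℝ)..x, 4 * Real.pi * Real.exp (C / a) * s ^ (n - 4) :=
        intervalIntegral.integral_mono_on_of_le_Ioo hx.1.le
          ((intervalIntegrable_iff_integrableOn_Ioc_of_le hx.1.le).2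
            (hD.integrableOn.mono_set Ioc_subset_Ioi_self))
          ((intervalIntegral.intervalIntegrable_rpow' (by linarith)).const_mul _)
          fun s hs => h.massRate_le ⟨hs.1, hs.2.le.trans hx.2⟩
    _ = _ := by
        rw [intervalIntegral.integral_const_mul, integral_rpow (Or.inl (by linarith)),
          show n - 4 + 1 = n - 3 by ring, Real.zero_rpow (by linarith)]
        ring

theorem enclosedMass_of_one_le (h : IsDensitySlope κ n a C) (hx : 1 ≤ x) :
    enclosedMass (slopeDensity n κ) x = 4 * Real.pi / 3 * x ^ (-3 : ℝ) := by
  calc enclosedMass (slopeDensity n κ) x = ∫ s in Ioi x, 4 * Real.pi * s ^ (-4 : ℝ) :=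
        setIntegral_congr_fun measurableSet_Ioi fun s hs =>
          h.massRate_of_one_le (hx.trans (le_of_lt hs))
    _ = 4 * Real.pi / 3 * x ^ (-3 : ℝ) := by
        rw [integral_const_mul, integral_Ioi_rpow_of_lt (by norm_num) (one_pos.trans_le hx)]
        norm_num
        ring

theorem exists_tendsto_newtonPotential (h : IsDensitySlope κ n a C) (hn : 3 < n) :
    ∃ uc, 0 < uc ∧ Tendsto (newtonPotential (slopeDensity n κ)) atTop (𝓝 uc) := by
  have hD := h.isStellarProfile hn
  have hint : IntegrableOn (enclosedMass (slopeDensity n κ)) (Ioi 0) := by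
    rw [← Ioc_union_Ioi_eq_Ioi zero_le_one]
    refine (hD.intervalIntegrable_enclosedMass zero_le_one).1.union ?_
    refine (integrableOn_congr_fun (fun s hs => h.enclosedMass_of_one_le (mem_Ioi.1 hs).le)
      measurableSet_Ioi).2 ?_
    exact (integrableOn_Ioi_rpow_of_lt (by norm_num) one_pos).const_mul _
  refine ⟨_, ?_, intervalIntegral_tendsto_integral_Ioi 0 hint tendsto_id⟩
  refine (hD.newtonPotential_pos one_pos).trans_le ?_
  rw [newtonPotential, intervalIntegral.integral_of_le zero_le_one]
  exact setIntegral_mono_set hint (ae_restrict_of_forall_mem measurableSet_Ioi fun s hs =>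
    (hD.enclosedMass_pos (le_of_lt hs)).le) Ioc_subset_Ioi_self.eventuallyLE

end IsDensitySlope

end DensitySlope

section ExtendedPotential

/-- A potential that agrees with `newtonPotential D` for `x ≤ 1` and is unbounded. Its inverse
continues the equation of state of a body with constant density in `x ≥ 1` to all `η`. -/
noncomputable def extendedPotential (D : ℝ → ℝ) (x : ℝ) : ℝ :=
  newtonPotential D x + max (x - 1) 0 ^ 3

/-- The derivative of `extendedPotential D`. -/
noncomputable def extendedMass (D : ℝ → ℝ) (x : ℝ) : ℝ := enclosedMass D x + 3 * max (x - 1) 0 ^ 2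

theorem extendedPotential_of_le_one {D : ℝ → ℝ} {x : ℝ} (hx : x ≤ 1) :
    extendedPotential D x = newtonPotential D x := by
  simp [extendedPotential, hx]

theorem extendedMass_of_le_one {D : ℝ → ℝ} {x : ℝ} (hx : x ≤ 1) :
    extendedMass D x = enclosedMass D x := by
  simp [extendedMass, hx]

namespace IsStellarProfile

variable {D : ℝ → ℝ} {x y : ℝ}

theorem extendedMass_pos (h : IsStellarProfile D) (hx : 0 ≤ x) : 0 < extendedMass D x :=
  add_pos_of_pos_of_nonneg (h.enclosedMass_pos hx) (by positivity)

theorem extendedPotential_pos (h : IsStellarProfile D) (hx : 0 < x) : 0 < extendedPotential D x :=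
  add_pos_of_pos_of_nonneg (h.newtonPotential_pos hx) (by positivity)

theorem hasDerivAt_extendedPotential (h : IsStellarProfile D) (hx : 0 < x) :
    HasDerivAt (extendedPotential D) (extendedMass D x) x := by
  refine ((h.hasDerivAt_newtonPotential hx).add
    ((hasDerivAt_max_zero_pow 1 (x - 1)).comp_sub_const x 1)).congr_deriv ?_
  norm_num [extendedMass]

theorem contDiffOn_extendedMass (h : IsStellarProfile D) :
    ContDiffOn ℝ 1 (extendedMass D) (Ioi 0) := by
  refine contDiffOn_one_of_hasDerivAt isOpen_Ioi (fun x hx => (h.hasDerivAt_enclosedMass hx).add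
    (((hasDerivAt_max_zero_pow 0 (x - 1)).comp_sub_const x 1).const_mul 3)) ?_
  exact (continuousOn_massRate (h.continuousOn.mono Ioi_subset_Ici_self)).neg.add (by fun_prop)

theorem contDiffOn_extendedPotential (h : IsStellarProfile D) :
    ContDiffOn ℝ 1 (extendedPotential D) (Ioi 0) :=
  contDiffOn_one_of_hasDerivAt isOpen_Ioi (fun _ hx => h.hasDerivAt_extendedPotential hx)
    h.contDiffOn_extendedMass.continuousOn

theorem exists_orderIso_eqOn_extendedPotential (h : IsStellarProfile D) :
    ∃ e : ℝ ≃o ℝ, EqOn e (extendedPotential D) (Ici 0) := by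
  have hcont : ContinuousOn (extendedPotential D) (Ici 0) :=
    h.continuousOn_newtonPotential.add (by fun_prop)
  refine exists_orderIso_eqOn_Ici hcont ?_ ?_
  · refine strictMonoOn_of_deriv_pos (convex_Ici 0) hcont fun x hx => ?_
    rw [interior_Ici, mem_Ioi] at hx
    rw [(h.hasDerivAt_extendedPotential hx).deriv]
    exact h.extendedMass_pos hx.le
  · have hcube : Tendsto (fun x : ℝ => max (x - 1) 0 ^ 3) atTop atTop :=
      (tendsto_pow_atTop three_ne_zero).comp
        (tendsto_atTop_mono (fun _ => le_max_left _ _)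
          (tendsto_atTop_add_const_right _ (-1) tendsto_id))
    refine tendsto_atTop_mono' atTop ?_ hcube
    filter_upwards [eventually_gt_atTop 0] with x hx
    exact le_add_of_nonneg_left (h.newtonPotential_pos hx).le

/-- `extendedPotential D`, continued from `[0, ∞)` to an order isomorphism of `ℝ`; its inverse
recovers `x` from the potential. -/
noncomputable def potentialIso (h : IsStellarProfile D) : ℝ ≃o ℝ :=
  h.exists_orderIso_eqOn_extendedPotential.choose

theorem potentialIso_apply (h : IsStellarProfile D) (hx : 0 ≤ x) :
    h.potentialIso x = extendedPotential D x :=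
  h.exists_orderIso_eqOn_extendedPotential.choose_spec hx

theorem potentialIso_symm_zero (h : IsStellarProfile D) : h.potentialIso.symm 0 = 0 := by
  rw [OrderIso.symm_apply_eq, h.potentialIso_apply le_rfl, extendedPotential_of_le_one zero_le_one,
    newtonPotential, intervalIntegral.integral_same]

theorem potentialIso_symm_nonneg (h : IsStellarProfile D) (hy : 0 ≤ y) :
    0 ≤ h.potentialIso.symm y :=
  h.potentialIso_symm_zero ▸ h.potentialIso.symm.monotone hy

theorem potentialIso_symm_pos (h : IsStellarProfile D) (hy : 0 < y) :
    0 < h.potentialIso.symm y :=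
  h.potentialIso_symm_zero ▸ h.potentialIso.symm.strictMono hy

theorem extendedPotential_potentialIso_symm (h : IsStellarProfile D) (hy : 0 ≤ y) :
    extendedPotential D (h.potentialIso.symm y) = y := by
  rw [← h.potentialIso_apply (h.potentialIso_symm_nonneg hy), OrderIso.apply_symm_apply]

theorem hasDerivAt_potentialIso_symm (h : IsStellarProfile D) (hy : 0 < y) :
    HasDerivAt h.potentialIso.symm (extendedMass D (h.potentialIso.symm y))⁻¹ y := by
  have hx := h.potentialIso_symm_pos hy
  refine hasDerivAt_orderIso_symm ?_ (h.extendedMass_pos hx.le).ne'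
  refine (h.hasDerivAt_extendedPotential hx).congr_of_eventuallyEq ?_
  filter_upwards [eventually_gt_nhds hx] with z hz using h.potentialIso_apply hz.le

theorem contDiffOn_potentialIso_symm (h : IsStellarProfile D) :
    ContDiffOn ℝ 1 h.potentialIso.symm (Ioi 0) :=
  contDiffOn_one_of_hasDerivAt isOpen_Ioi (fun _ hy => h.hasDerivAt_potentialIso_symm hy) <|
    (h.contDiffOn_extendedMass.continuousOn.comp h.potentialIso.symm.continuous.continuousOn
      fun _ hy => h.potentialIso_symm_pos hy).inv₀
      fun _ hy => (h.extendedMass_pos (h.potentialIso_symm_pos hy).le).ne'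

theorem tendsto_potentialIso_symm_nhdsGT_zero (h : IsStellarProfile D) :
    Tendsto h.potentialIso.symm (𝓝[>] 0) (𝓝[>] 0) := by
  refine tendsto_nhdsWithin_iff.2 ⟨?_, ?_⟩
  · have hcont := h.potentialIso.symm.continuous.tendsto 0
    rw [h.potentialIso_symm_zero] at hcont
    exact hcont.mono_left nhdsWithin_le_nhds
  · filter_upwards [self_mem_nhdsWithin] with y hy using h.potentialIso_symm_pos hy

theorem isBigO_potentialIso_symm (h : IsStellarProfile D) :
    h.potentialIso.symm =O[𝓝[>] 0] fun y => y := by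
  have hm := h.enclosedMass_pos zero_le_one
  have hle : ∀ᶠ y in 𝓝[>] 0, h.potentialIso.symm y ∈ Ioc 0 1 :=
    h.tendsto_potentialIso_symm_nhdsGT_zero.eventually (Ioc_mem_nhdsGT one_pos)
  refine IsBigO.of_bound (enclosedMass D 1)⁻¹ ?_
  filter_upwards [hle, self_mem_nhdsWithin] with y hxy (hy : 0 < y)
  rw [Real.norm_of_nonneg hxy.1.le, Real.norm_of_nonneg hy.le, inv_mul_eq_div, le_div_iff₀ hm]
  calc h.potentialIso.symm y * enclosedMass D 1
      ≤ h.potentialIso.symm y * enclosedMass D (h.potentialIso.symm y) :=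
        mul_le_mul_of_nonneg_left
          (h.strictAntiOn_enclosedMass.antitoneOn hxy.1.le (mem_Ici.2 zero_le_one) hxy.2)
          hxy.1.le
    _ ≤ newtonPotential D (h.potentialIso.symm y) := h.mul_enclosedMass_le_newtonPotential hxy.1.le
    _ = y := by
        rw [← extendedPotential_of_le_one hxy.2, h.extendedPotential_potentialIso_symm hy.le]

theorem comp_potentialIso_symm_newtonPotential (h : IsStellarProfile D)
    (hD : ∀ x, 1 ≤ x → D x = 1) (hx : 0 ≤ x) :
    D (h.potentialIso.symm (newtonPotential D x)) = D x := by
  have hinv : ∀ {z}, 0 ≤ z → z ≤ 1 → h.potentialIso.symm (newtonPotential D z) = z := by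
    intro z hz hz1
    rw [OrderIso.symm_apply_eq, h.potentialIso_apply hz, extendedPotential_of_le_one hz1]
  rcases le_total x 1 with hx1 | hx1
  · rw [hinv hx hx1]
  · have hmono : newtonPotential D 1 ≤ newtonPotential D x :=
      intervalIntegral.integral_mono_interval le_rfl zero_le_one hx1
        (ae_restrict_of_forall_mem measurableSet_Ioc fun s hs => (h.enclosedMass_pos hs.1.le).le)
        (h.intervalIntegrable_enclosedMass hx)
    rw [hD x hx1, hD _ ((hinv zero_le_one le_rfl).symm.trans_le
      (h.potentialIso.symm.monotone hmono))]

theorem exists_isPressureOf_comp_potentialIso_symm (h : IsStellarProfile D)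
    (hD : ∀ x, 1 ≤ x → D x = 1) : ∃ P, IsPressureOf (D ∘ h.potentialIso.symm) P := by
  refine exists_isPressureOf (h.continuousOn.comp h.potentialIso.symm.continuous.continuousOn
    fun y hy => h.potentialIso_symm_nonneg hy) (fun y hy => h.pos _ (h.potentialIso_symm_pos hy))
    one_pos ?_
  filter_upwards [h.potentialIso.symm.tendsto_atTop.eventually_ge_atTop 1] with y hy
  exact (hD _ hy).ge

theorem abs_newtonPotential_div_sub_one_le (h : IsStellarProfile D) (hx : x ∈ Ioc (0 : ℝ) 1) :
    |newtonPotential D x / (x * enclosedMass D x) - 1| ≤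
      (enclosedMass D 0 - enclosedMass D x) / enclosedMass D 1 := by
  have hx0 := hx.1
  have hm := h.enclosedMass_pos hx0.le
  have hanti := h.strictAntiOn_enclosedMass.antitoneOn
  have hlower : 1 ≤ newtonPotential D x / (x * enclosedMass D x) :=
    (one_le_div (by positivity)).2 (h.mul_enclosedMass_le_newtonPotential hx0.le)
  rw [abs_of_nonneg (sub_nonneg.2 hlower)]
  calc newtonPotential D x / (x * enclosedMass D x) - 1
      ≤ x * enclosedMass D 0 / (x * enclosedMass D x) - 1 := by
        gcongr
        exact h.newtonPotential_le_mul_enclosedMass_zero hx0.le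
    _ = (enclosedMass D 0 - enclosedMass D x) / enclosedMass D x := by field_simp
    _ ≤ (enclosedMass D 0 - enclosedMass D x) / enclosedMass D 1 :=
        div_le_div_of_nonneg_left (sub_nonneg.2 (hanti self_mem_Ici hx0.le hx0.le))
          (h.enclosedMass_pos zero_le_one) (hanti hx0.le (mem_Ici.2 zero_le_one) hx.2)

end IsStellarProfile

end ExtendedPotential

section IndexProfile

/-- The index `d log ρ / d log η` as a function of `x`, for the density with logarithmic slope `κ`
and the potential `η = extendedPotential`. -/
noncomputable def indexProfile (n : ℝ) (κ : ℝ → ℝ) (x : ℝ) : ℝ :=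
  κ x * extendedPotential (slopeDensity n κ) x / (x * extendedMass (slopeDensity n κ) x)

namespace IsDensitySlope

variable {κ : ℝ → ℝ} {n a C x : ℝ}

theorem indexProfile_nonneg (h : IsDensitySlope κ n a C) (hn : 3 < n) (hx : 0 < x) :
    0 ≤ indexProfile n κ x := by
  have hD := h.isStellarProfile hn
  exact div_nonneg (mul_nonneg (h.nonneg x hx) (hD.extendedPotential_pos hx).le)
    (mul_pos hx (hD.extendedMass_pos hx.le)).le

theorem indexProfile_eq_zero (h : IsDensitySlope κ n a C) (hx : 1 ≤ x) :
    indexProfile n κ x = 0 := by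
  rw [indexProfile, h.eq_zero x hx, zero_mul, zero_div]

theorem contDiffOn_indexProfile (h : IsDensitySlope κ n a C) (hn : 3 < n) :
    ContDiffOn ℝ 1 (indexProfile n κ) (Ioi 0) :=
  have hD := h.isStellarProfile hn
  (h.contDiffOn.mul hD.contDiffOn_extendedPotential).div
    (contDiffOn_id.mul hD.contDiffOn_extendedMass) fun _ hx =>
      (mul_pos hx (hD.extendedMass_pos (le_of_lt hx))).ne'

theorem exists_abs_newtonPotential_div_sub_one_le (h : IsDensitySlope κ n a C) (hn : 3 < n) :
    ∃ K, 0 ≤ K ∧ ∀ x ∈ Ioc (0 : ℝ) 1,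
      |newtonPotential (slopeDensity n κ) x / (x * enclosedMass (slopeDensity n κ) x) - 1| ≤
        K * x ^ (n - 3) := by
  have hD := h.isStellarProfile hn
  have hm := hD.enclosedMass_pos zero_le_one
  have := sub_pos.2 hn
  refine ⟨4 * Real.pi * Real.exp (C / a) / (n - 3) / enclosedMass (slopeDensity n κ) 1,
    by positivity, fun x hx => (hD.abs_newtonPotential_div_sub_one_le hx).trans ?_⟩
  rw [div_mul_eq_mul_div]
  exact div_le_div_of_nonneg_right (h.enclosedMass_zero_sub_le hn hx) hm.le

theorem exists_abs_indexProfile_sub_le (h : IsDensitySlope κ n a C) (hn : 3 < n) :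
    ∃ A, ∀ x ∈ Ioc (0 : ℝ) 1, |indexProfile n κ x - n| ≤ A * x ^ min a (n - 3) := by
  obtain ⟨K, hK, hq⟩ := h.exists_abs_newtonPotential_div_sub_one_le hn
  refine ⟨C * (K + 1) + n * K, fun x hx => ?_⟩
  specialize hq x hx
  set q := newtonPotential (slopeDensity n κ) x / (x * enclosedMass (slopeDensity n κ) x)
  have hq_le : |q| ≤ K + 1 := by
    have hx_le : x ^ (n - 3) ≤ 1 := Real.rpow_le_one hx.1.le hx.2 (sub_nonneg.2 hn.le)
    calc |q| ≤ |q - 1| + 1 := by simpa using abs_add_le (q - 1) 1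
      _ ≤ K * 1 + 1 := by grw [hq, hx_le]
      _ = K + 1 := by rw [mul_one]
  have hsplit : indexProfile n κ x - n = (κ x - n) * q + n * (q - 1) := by
    rw [indexProfile, extendedPotential_of_le_one hx.2, extendedMass_of_le_one hx.2]
    ring
  have hC := h.bound_nonneg
  have hxa : x ^ a ≤ x ^ min a (n - 3) :=
    Real.rpow_le_rpow_of_exponent_ge hx.1 hx.2 (min_le_left _ _)
  have hxn : x ^ (n - 3) ≤ x ^ min a (n - 3) :=
    Real.rpow_le_rpow_of_exponent_ge hx.1 hx.2 (min_le_right _ _)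
  calc |indexProfile n κ x - n| ≤ |κ x - n| * |q| + n * |q - 1| := by
        rw [hsplit]
        refine (abs_add_le _ _).trans_eq ?_
        rw [abs_mul, abs_mul, abs_of_pos (three_pos.trans hn)]
    _ ≤ (C * x ^ a) * (K + 1) + n * (K * x ^ (n - 3)) := by
        have := hx.1
        gcongr
        exact h.abs_sub_le x hx
    _ ≤ (C * x ^ min a (n - 3)) * (K + 1) + n * (K * x ^ min a (n - 3)) := by gcongr
    _ = (C * (K + 1) + n * K) * x ^ min a (n - 3) := by ring

theorem exists_abs_indexProfile_le (h : IsDensitySlope κ n a C) (hn : 3 < n) :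
    ∃ B, ∀ x, 0 < x → |indexProfile n κ x| ≤ B := by
  obtain ⟨A, hA⟩ := h.exists_abs_indexProfile_sub_le hn
  refine ⟨|A| + |n|, fun x hx => ?_⟩
  rcases le_total x 1 with hx1 | hx1
  · have hpow : x ^ min a (n - 3) ≤ 1 :=
      Real.rpow_le_one hx.le hx1 (le_min h.exponent_pos.le (sub_nonneg.2 hn.le))
    calc |indexProfile n κ x| ≤ |indexProfile n κ x - n| + |n| := by
          simpa using abs_add_le (indexProfile n κ x - n) n
      _ ≤ |A| * x ^ min a (n - 3) + |n| := by
          grw [hA x ⟨hx, hx1⟩, le_abs_self A]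
      _ ≤ |A| * 1 + |n| := by gcongr
      _ = |A| + |n| := by rw [mul_one]
  · rw [h.indexProfile_eq_zero hx1, abs_zero]
    positivity

theorem isBigO_indexProfile_sub (h : IsDensitySlope κ n a C) (hn : 3 < n) :
    (fun x => indexProfile n κ x - n) =O[𝓝[>] 0] fun x => x ^ min a (n - 3) := by
  obtain ⟨A, hA⟩ := h.exists_abs_indexProfile_sub_le hn
  refine IsBigO.of_bound A ?_
  filter_upwards [Ioc_mem_nhdsGT one_pos] with x hx
  rw [Real.norm_of_nonneg (Real.rpow_nonneg hx.1.le _)]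
  exact hA x hx

theorem hasDerivAt_slopeDensity_comp_potentialIso_symm (h : IsDensitySlope κ n a C)
    (hD : IsStellarProfile (slopeDensity n κ)) {y : ℝ} (hy : 0 < y) :
    HasDerivAt (slopeDensity n κ ∘ hD.potentialIso.symm)
      (indexProfile n κ (hD.potentialIso.symm y) *
        (slopeDensity n κ ∘ hD.potentialIso.symm) y / y) y := by
  have hx := hD.potentialIso_symm_pos hy
  refine ((h.hasDerivAt_slopeDensity hx).comp y (hD.hasDerivAt_potentialIso_symm hy)).congr_deriv ?_
  have hm := (hD.extendedMass_pos hx.le).ne'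
  rw [indexProfile, hD.extendedPotential_potentialIso_symm hy.le, Function.comp_apply]
  field_simp

theorem isAsymptoticallyPolytropic (h : IsDensitySlope κ n a C) (hn : 3 < n)
    {P : ℝ ≃o ℝ}
    (hP : IsPressureOf (slopeDensity n κ ∘ (h.isStellarProfile hn).potentialIso.symm) P) :
    IsAsymptoticallyPolytropic
      ((slopeDensity n κ ∘ (h.isStellarProfile hn).potentialIso.symm) ∘ P.symm) n 0 := by
  have hD := h.isStellarProfile hn
  have hpos := fun {y : ℝ} (hy : 0 < y) => hD.potentialIso_symm_pos hy
  obtain ⟨B, hB⟩ := h.exists_abs_indexProfile_le hn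
  have ha : 0 < min a (n - 3) := lt_min h.exponent_pos (sub_pos.2 hn)
  refine ⟨hP.isEquationOfState, hP.tendsto_eta, indexProfile n κ ∘ hD.potentialIso.symm,
    hP.isIndexFunction fun y hy => h.hasDerivAt_slopeDensity_comp_potentialIso_symm hD hy,
    (h.contDiffOn_indexProfile hn).comp hD.contDiffOn_potentialIso_symm fun y hy => hpos hy,
    fun y hy => h.indexProfile_nonneg hn (hpos hy), ⟨B, fun y hy => hB _ (hpos hy)⟩,
    ⟨min a (n - 3), ha, ?_⟩, 1, one_pos, ?_⟩
  · refine ((h.isBigO_indexProfile_sub hn).comp_tendsto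
      hD.tendsto_potentialIso_symm_nhdsGT_zero).trans (hD.isBigO_potentialIso_symm.rpow ha.le ?_)
    filter_upwards [self_mem_nhdsWithin] with y hy using le_of_lt hy
  · refine (isBigO_zero _ _).congr' ?_ EventuallyEq.rfl
    filter_upwards [hD.potentialIso.symm.tendsto_atTop.eventually_ge_atTop 1] with y hy
    rw [Function.comp_apply, h.indexProfile_eq_zero hy, sub_zero]

theorem exists_isAsymptoticallyPolytropic_isRegularSolution (h : IsDensitySlope κ n a C)
    (hn : 3 < n) : ∃ ρ, IsAsymptoticallyPolytropic ρ n 0 ∧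
      ∃ (pc : ℝ) (m p : ℝ → ℝ), IsRegularSolution ρ pc ⊤ m p := by
  have hD := h.isStellarProfile hn
  have hD_one : ∀ x, 1 ≤ x → slopeDensity n κ x = 1 := fun _ hx => h.slopeDensity_eq_one hx
  obtain ⟨P, hP⟩ := hD.exists_isPressureOf_comp_potentialIso_symm hD_one
  obtain ⟨uc, huc, hlim⟩ := h.exists_tendsto_newtonPotential hn
  refine ⟨_, h.isAsymptoticallyPolytropic hn hP, _, _, _,
    hP.isRegularSolution (fun x hx => ?_) (fun x hx => hD.hasDerivAt_newtonPotential hx)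
      (fun x hx => hD.newtonPotential_pos hx) (tendsto_enclosedMass_atTop _) hlim huc⟩
  rw [Function.comp_apply, hD.comp_potentialIso_symm_newtonPotential hD_one hx.le]
  exact hD.hasDerivAt_enclosedMass hx

end IsDensitySlope

theorem isDensitySlope_mul_max_sq {n : ℝ} (hn : 0 ≤ n) :
    IsDensitySlope (fun x => n * max (1 - x) 0 ^ 2) n 1 (2 * n) where
  exponent_pos := one_pos
  contDiffOn := contDiffOn_one_of_hasDerivAt isOpen_Ioi
    (fun x _ => ((hasDerivAt_max_zero_pow 0 (1 - x)).comp_const_sub 1 x).const_mul n) (by fun_prop)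
  nonneg x _ := by positivity
  eq_zero x hx := by simp [hx]
  abs_sub_le x hx := by
    rw [max_eq_left (sub_nonneg.2 hx.2), Real.rpow_one, ← mul_sub_one, abs_mul, abs_of_nonneg hn,
      mul_assoc, mul_left_comm]
    gcongr
    rw [abs_le]
    constructor <;> nlinarith [hx.1, hx.2]

end IndexProfile

theorem theorem4 (n₀ : ℝ) (hn₀ : 3 < n₀) :
    ∃ (ρ : ℝ → ℝ) (n₁ : ℝ), IsAsymptoticallyPolytropic ρ n₀ n₁ ∧
      ∃ (pc : ℝ) (m p : ℝ → ℝ), IsRegularSolution ρ pc ⊤ m p := by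
  have hslope := isDensitySlope_mul_max_sq (three_pos.trans hn₀).le
  obtain ⟨ρ, hρ, hsol⟩ := hslope.exists_isAsymptoticallyPolytropic_isRegularSolution hn₀
  exact ⟨ρ, 0, hρ, hsol⟩
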